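/- Let $n\ge 0$ be an integer, let $0<\xi_1<\dots<\xi_n<1$ and $g_1,\dots,g_n>0$, and let $g=\sum_{i=1}^n g_i\,\delta_{\xi_i}$. Consider the cubic string equation $$-\phi_{\xi\xi\xi}=z\,g\,\phi\quad\text{on }(0,1),$$ for functions $\phi$ continuous on $[0,1]$, in the sense of distributions, with spectral parameter $z\in\mathbb C$. (Derivatives at $0$ and $1$ are one-sided.) The boundary value problem of Type $a\in\{0,1,2\}$ is this equation with $\phi(0)=\phi_\xi(0)=0$ and, at the other end, $\phi(1)=0$ (Type 0), $\phi_\xi(1)=0$ (Type 1), $\phi_{\xi\xi}(1)=0$ (Type 2); the spectrum of Type $a$ is the set of $z\in\mathbb C$ for which it has a solution that is not identically zero. Write $(f,h)_g=\int_0^1 fh\,dg=\sum_{i=1}^n g_i f(\xi_i)h(\xi_i)$. For every $z\in\mathbb C$ the initial value problem $\phi(0)=\phi_\xi(0)=0$, $\phi_{\xi\xi}(0)=1$ for the equation has a unique solution $\phi(\cdot\,;z)$ on $[0,1]$, and the following hold. 1. For each $a=0,1,2$ the spectrum of Type $a$ consists of exactly $n$ points $z_{a,1}<\dots<z_{a,n}$,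 all real and positive, and it is simple: the eigenspace of $z_{a,j}$ is spanned by $\phi_{a,j}:=\phi(\cdot\,;z_{a,j})$, and $z_{a,j}$ is a simple zero of $z\mapsto\partial_\xi^a\phi(1;z)$. 2. The spectra interlace: $z_{2,j}<z_{1,j}<z_{0,j}$ for $1\le j\le n$, and $z_{0,j}<z_{2,j+1}$ for $1\le j<n$. 3. For each $a=0,1,2$ the eigenfunctions $\phi_{a,1},\dots,\phi_{a,n}$ are linearly independent, both as functions on $[0,1]$ and as elements of $L^2_g[0,1]$. 4. For all $1\le i,j\le n$, $$(\phi_{0,i},\phi_{0,j})_g=\frac{\phi_{0,i,\xi}(1)\,\phi_{0,j,\xi}(1)}{z_{0,i}+z_{0,j}},\qquad (\phi_{0,i},\phi_{1,j})_g=-\frac{\phi_{0,i,\xi\xi}(1)\,\phi_{1,j}(1)}{z_{0,i}+z_{1,j}},$$ $$(\phi_{1,i},\phi_{2,j})_g=-\frac{\phi_{1,i,\xi\xi}(1)\,\phi_{2,j}(1)}{z_{1,i}+z_{2,j}},\qquad (\phi_{2,i},\phi_{2,j})_g=\frac{\phi_{2,i,\xi}(1)\,\phi_{2,j,\xi}(1)}{z_{2,i}+z_{2,j}}.$$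 -/

import Mathlib

open MeasureTheory Set

/-- A discrete cubic string on `[0,1]`: `n` point masses `g i > 0` placed at positions
`0 < x 0 < x 1 < ⋯ < x (n-1) < 1`. -/
structure DiscreteCubicString (n : ℕ) where
  /-- the masses -/
  g : Fin n → ℝ
  /-- their positions -/
  x : Fin n → ℝ
  g_pos : ∀ i, 0 < g i
  x_strictMono : StrictMono x
  x_mem : ∀ i, x i ∈ Ioo (0 : ℝ) 1

namespace DiscreteCubicString

variable {n : ℕ} (S : DiscreteCubicString n)

/-- The mass distribution `∑ i, g i • δ_{x i}` as a measure on the line (it is carried by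
the open interval `(0,1)`). -/
noncomputable def mass : Measure ℝ :=
  ∑ i, ENNReal.ofReal (S.g i) • Measure.dirac (S.x i)

/-- The bilinear form `(f, h)_g = ∫ f h dg`. -/
noncomputable def form (f h : ℝ → ℂ) : ℂ := ∫ ξ, f ξ * h ξ ∂S.mass

/-- `f` is continuous on `[0,1]` and satisfies the cubic string equation `-f''' = z g f` on
`(0,1)` in the sense of distributions: three integrations by parts turn
`-⟨f''', ψ⟩` into `∫ f ψ'''`. Only the values of `f` on `[0,1]` matter. -/
def SolvesEquation (z : ℂ) (f : ℝ → ℂ) : Prop :=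
  ContinuousOn f (Icc 0 1) ∧
    ∀ ψ : ℝ → ℝ, ContDiff ℝ (⊤ : ℕ∞) ψ → HasCompactSupport ψ → tsupport ψ ⊆ Ioo 0 1 →
      ∫ ξ in (0 : ℝ)..1, f ξ * ((iteratedDeriv 3 ψ ξ : ℝ) : ℂ) = z * ∫ ξ, f ξ * ((ψ ξ : ℝ) : ℂ) ∂S.mass

end DiscreteCubicString

/-- The derivative of order `k` of a function on the string `[0,1]`, one-sided at the two
end points. -/
noncomputable def stringDeriv (k : ℕ) (f : ℝ → ℂ) (ξ : ℝ) : ℂ :=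
  iteratedDerivWithin k f (Icc (0 : ℝ) 1) ξ

namespace DiscreteCubicString

variable {n : ℕ} (S : DiscreteCubicString n)

/-- The initial value problem: `f` solves the cubic string equation with spectral parameter
`z`, and `f(0) = f'(0) = 0`, `f''(0) = 1`. -/
def SolvesIVP (z : ℂ) (f : ℝ → ℂ) : Prop :=
  S.SolvesEquation z f ∧
    stringDeriv 0 f 0 = 0 ∧ stringDeriv 1 f 0 = 0 ∧ stringDeriv 2 f 0 = 1

/-- `f` is an eigenfunction, for the spectral parameter `z`, of the boundary value problem of
type `a`: a solution of the cubic string equation, not identically zero on `[0,1]`, such that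
`f(0) = f'(0) = 0`, and `f(1) = 0` (`a = 0`), `f'(1) = 0` (`a = 1`), `f''(1) = 0` (`a = 2`). -/
def IsEigenfunction (a : Fin 3) (z : ℂ) (f : ℝ → ℂ) : Prop :=
  S.SolvesEquation z f ∧
    stringDeriv 0 f 0 = 0 ∧ stringDeriv 1 f 0 = 0 ∧ stringDeriv (a : ℕ) f 1 = 0 ∧
    ∃ ξ ∈ Icc (0 : ℝ) 1, f ξ ≠ 0

/-- The spectrum of the boundary value problem of type `a`: its complex eigenvalues. -/
def spectrum (a : Fin 3) : Set ℂ := {z | ∃ f, S.IsEigenfunction a z f}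

end DiscreteCubicString

/-!
The derivatives `φ, φ', φ''` of the solution at a point are polynomials in `z`. Crossing a mass `g`
replaces `φ''` by `φ'' - g z φ`, and a massless interval acts by Taylor's formula. Either step
consists in adding polynomials whose zeros interlace. By the intermediate value theorem the zeros
of the sum are again real, simple and interlaced with the old ones, so by induction on the number
of masses `φ, φ', φ''` at the right end have interlacing positive zeros.

By the Du Bois-Reymond lemma, a solution in the sense of distributions is the sum of a quadratic
polynomial and of multiples of truncated powers centred at the masses; hence it is determined by
its data at `0`. The value of `φ` at the `k`-th mass has degree exactly `k` in `z`, so linear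
independence is the nonvanishing of a Vandermonde determinant. Finally
`(z + w) (φ(z), φ(w))_g` telescopes to boundary terms at `1`, two of which vanish when `z` and `w`
are eigenvalues of the types considered.
-/

section RealRootedPolynomials

open Polynomial

/-- `p` is a polynomial of degree `n`, positive near `-∞`, with the zeros `ζ 0, …, ζ (n - 1)`
counted with multiplicity. Only these values of the sequence `ζ` matter. -/
def HasRootSeq (p : ℝ[X]) (n : ℕ) (ζ : ℕ → ℝ) : Prop :=
  ∃ c : ℝ, 0 < c ∧ p = C c * ∏ j ∈ Finset.range n, (C (ζ j) - X)

variable {p q : ℝ[X]} {n : ℕ} {α β ζ : ℕ → ℝ}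

theorem natDegree_prod_C_sub_X (n : ℕ) (ζ : ℕ → ℝ) :
    (∏ j ∈ Finset.range n, (C (ζ j) - X)).natDegree = n := by
  have hlin (a : ℝ) : (C a - X).natDegree = 1 := by
    rw [← neg_sub, natDegree_neg, natDegree_X_sub_C]
  rw [natDegree_prod _ _ fun j _ => ne_zero_of_natDegree_gt (n := 0) (by simp [hlin])]
  simp [hlin]

theorem coeff_prod_C_sub_X (n : ℕ) (ζ : ℕ → ℝ) :
    (∏ j ∈ Finset.range n, (C (ζ j) - X)).coeff n = (-1) ^ n := by
  have hlin (a : ℝ) : (C a - X).leadingCoeff = -1 := by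
    rw [← neg_sub, leadingCoeff_neg, leadingCoeff_X_sub_C]
  have hcoeff := coeff_natDegree (p := ∏ j ∈ Finset.range n, (C (ζ j) - X))
  rw [natDegree_prod_C_sub_X, leadingCoeff_prod] at hcoeff
  simpa [hlin] using hcoeff

namespace HasRootSeq

theorem eval_eq_zero (h : HasRootSeq p n ζ) {j : ℕ} (hj : j < n) : p.eval (ζ j) = 0 := by
  obtain ⟨c, -, rfl⟩ := h
  rw [eval_mul, eval_prod, Finset.prod_eq_zero (Finset.mem_range.2 hj) (by simp), mul_zero]

theorem natDegree_eq (h : HasRootSeq p n ζ) : p.natDegree = n := by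
  obtain ⟨c, hc, rfl⟩ := h
  rw [natDegree_C_mul hc.ne', natDegree_prod_C_sub_X]

theorem neg_one_pow_mul_coeff_pos (h : HasRootSeq p n ζ) : 0 < (-1) ^ n * p.coeff n := by
  obtain ⟨c, hc, rfl⟩ := h
  rwa [coeff_C_mul, coeff_prod_C_sub_X, mul_left_comm, ← mul_pow, neg_mul_neg, one_mul, one_pow,
    mul_one]

theorem ne_zero (h : HasRootSeq p n ζ) : p ≠ 0 := by
  rintro rfl
  simpa using h.neg_one_pow_mul_coeff_pos

theorem neg_one_pow_mul_eval_pos (h : HasRootSeq p n ζ) {k : ℕ} (hk : k ≤ n) {w : ℝ}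
    (hlt : ∀ j < k, ζ j < w) (hgt : ∀ j, k ≤ j → j < n → w < ζ j) :
    0 < (-1) ^ k * p.eval w := by
  obtain ⟨c, hc, rfl⟩ := h
  have hflip : (-1 : ℝ) ^ k * ∏ j ∈ Finset.range k, (ζ j - w) =
      ∏ j ∈ Finset.range k, (w - ζ j) := by
    simpa only [Finset.card_range, neg_sub] using
      (Finset.prod_neg (s := Finset.range k) (f := fun j => ζ j - w)).symm
  have hleft : 0 < ∏ j ∈ Finset.range k, (w - ζ j) :=
    Finset.prod_pos fun j hj => sub_pos.2 (hlt j (Finset.mem_range.1 hj))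
  have hright : 0 < ∏ j ∈ Finset.Ico k n, (ζ j - w) :=
    Finset.prod_pos fun j hj => sub_pos.2 (hgt j (Finset.mem_Ico.1 hj).1 (Finset.mem_Ico.1 hj).2)
  calc 0 < c * (∏ j ∈ Finset.range k, (w - ζ j)) * ∏ j ∈ Finset.Ico k n, (ζ j - w) := by
        positivity
    _ = (-1) ^ k * (C c * ∏ j ∈ Finset.range n, (C (ζ j) - X)).eval w := by
        rw [← hflip, eval_mul, eval_prod, eval_C, ← Finset.prod_range_mul_prod_Ico _ hk]
        simp only [eval_sub, eval_C, eval_X]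
        ring

theorem const_mul (h : HasRootSeq p n ζ) {c : ℝ} (hc : 0 < c) : HasRootSeq (C c * p) n ζ := by
  obtain ⟨c', hc', rfl⟩ := h
  exact ⟨c * c', mul_pos hc hc', by rw [C_mul, mul_assoc]⟩

theorem neg_X_mul (h : HasRootSeq p n ζ) :
    HasRootSeq (-X * p) (n + 1) fun j => j.casesOn 0 ζ := by
  obtain ⟨c, hc, rfl⟩ := h
  refine ⟨c, hc, ?_⟩
  rw [Finset.prod_range_succ', show (C (Nat.casesOn (motive := fun _ => ℝ) 0 0 ζ) : ℝ[X]) = 0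
    from C_0]
  ring

theorem of_eval_eq_zero (hζ : InjOn ζ (Finset.range n)) (hdeg : p.natDegree ≤ n)
    (hcoeff : 0 < (-1) ^ n * p.coeff n) (hroot : ∀ j < n, p.eval (ζ j) = 0) :
    HasRootSeq p n ζ := by
  have hdeg' : p.natDegree = n :=
    hdeg.antisymm (le_natDegree_of_ne_zero fun h => by simp [h] at hcoeff)
  have hq : HasRootSeq (C ((-1) ^ n * p.coeff n) * ∏ j ∈ Finset.range n, (C (ζ j) - X)) n ζ :=
    ⟨_, hcoeff, rfl⟩
  refine ⟨_, hcoeff, eq_of_degree_le_of_eval_index_eq _ hζ ?_ ?_ ?_ fun j hj => ?_⟩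
  · rw [Finset.card_range]
    exact degree_le_of_natDegree_le hdeg
  · rw [degree_eq_natDegree fun h => by simp [h] at hcoeff, degree_eq_natDegree hq.ne_zero,
      hdeg', hq.natDegree_eq]
  · rw [leadingCoeff, leadingCoeff, hdeg', hq.natDegree_eq, coeff_C_mul, coeff_prod_C_sub_X,
      mul_right_comm, ← mul_pow, neg_mul_neg, one_mul, one_pow, one_mul]
  · rw [hroot j (Finset.mem_range.1 hj), hq.eval_eq_zero (Finset.mem_range.1 hj)]

theorem aeval_eq_zero_iff (h : HasRootSeq p n ζ) {z : ℂ} :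
    aeval z p = 0 ↔ ∃ j < n, z = ζ j := by
  obtain ⟨c, hc, rfl⟩ := h
  simp [map_prod, Finset.prod_eq_zero_iff, hc.ne', sub_eq_zero, @eq_comm ℂ z]

theorem eval_derivative_ne_zero (h : HasRootSeq p n ζ) (hζ : InjOn ζ (Finset.range n)) {j : ℕ}
    (hj : j < n) : (derivative p).eval (ζ j) ≠ 0 := by
  obtain ⟨c, hc, rfl⟩ := h
  have hj' := Finset.mem_range.2 hj
  rw [← Finset.mul_prod_erase _ _ hj', derivative_C_mul, derivative_mul]
  simp only [derivative_sub, derivative_C, derivative_X, zero_sub, eval_mul, eval_add, eval_neg,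
    eval_sub, eval_C, eval_X, sub_self, zero_mul, add_zero, eval_prod, neg_mul, one_mul]
  refine mul_ne_zero hc.ne' (neg_ne_zero.2 (Finset.prod_ne_zero_iff.2 fun i hi => ?_))
  obtain ⟨hij, hi⟩ := Finset.mem_erase.1 hi
  exact sub_ne_zero.2 (hζ.ne hi hj' hij)

end HasRootSeq

theorem exists_lt_neg_one_pow_mul_eval_pos (hdeg : p.natDegree ≤ n + 1)
    (hcoeff : 0 < (-1) ^ (n + 1) * p.coeff (n + 1)) (B : ℝ) :
    ∃ M, B < M ∧ 0 < (-1) ^ (n + 1) * p.eval M := by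
  have hdeg' : (C ((-1) ^ (n + 1)) * p).natDegree = n + 1 := by
    rw [natDegree_C_mul (by simp)]
    exact hdeg.antisymm (le_natDegree_of_ne_zero fun h => by simp [h] at hcoeff)
  have htop := tendsto_atTop_of_leadingCoeff_nonneg (C ((-1) ^ (n + 1)) * p)
    (natDegree_pos_iff_degree_pos.1 (hdeg'.symm ▸ n.succ_pos))
    (by rw [leadingCoeff, hdeg', coeff_C_mul]; exact hcoeff.le)
  obtain ⟨M, hBM, hM⟩ :=
    ((Filter.eventually_gt_atTop B).and (htop.eventually_gt_atTop 0)).exists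
  exact ⟨M, hBM, by simpa using hM⟩

theorem exists_mem_Ioo_eval_eq_zero {s : ℝ} {a b : ℝ} (hab : a < b) (ha : 0 < s * p.eval a)
    (hb : 0 < -s * p.eval b) : ∃ z ∈ Ioo a b, p.eval z = 0 := by
  have hs : s ≠ 0 := left_ne_zero_of_mul ha.ne'
  obtain ⟨z, hz, hz0⟩ := intermediate_value_Ioo' (f := fun t => s * p.eval t) hab.le
    (by fun_prop) ⟨by linarith, ha⟩
  exact ⟨z, hz, (mul_eq_zero.1 hz0).resolve_left hs⟩

/-- `α 0 < β 0 < α 1 < ⋯ < β (n - 1) < α n`: the `n + 1` numbers `α 0, …, α n` are separated by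
the `n` numbers `β 0, …, β (n - 1)`. -/
def Interlaces (n : ℕ) (α β : ℕ → ℝ) : Prop :=
  ∀ j < n, α j < β j ∧ β j < α (j + 1)

namespace Interlaces

theorem left_lt_right (h : Interlaces n α β) {i j : ℕ} (hij : i ≤ j) (hj : j < n) :
    α i < β j := by
  induction j, hij using Nat.le_induction with
  | base => exact (h i hj).1
  | succ j _ ih => exact (ih (by omega)).trans ((h j (by omega)).2.trans (h (j + 1) hj).1)

theorem right_lt_left (h : Interlaces n α β) {i j : ℕ} (hij : i < j) (hj : j ≤ n) :
    β i < α j := by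
  induction j, hij using Nat.le_induction with
  | base => exact (h i hj).2
  | succ j _ ih => exact (ih (by omega)).trans ((h j hj).1.trans (h j hj).2)

theorem neg_one_pow_mul_eval_left_pos (h : Interlaces n α β) (hp : HasRootSeq p n β) {j : ℕ}
    (hj : j ≤ n) : 0 < (-1) ^ j * p.eval (α j) :=
  hp.neg_one_pow_mul_eval_pos hj (fun _ hi => h.right_lt_left hi hj)
    fun _ hji hi => h.left_lt_right hji hi

theorem neg_one_pow_mul_eval_right_pos (h : Interlaces n α β) (hq : HasRootSeq q (n + 1) α)
    {j : ℕ} (hj : j < n) : 0 < (-1) ^ (j + 1) * q.eval (β j) :=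
  hq.neg_one_pow_mul_eval_pos (by omega) (fun _ hi => h.left_lt_right (by omega) hj)
    fun _ hji hi => h.right_lt_left hji (by omega)

/-- At a zero of one summand the sum takes the value of the other one, so its signs at the
`α j` and `β j` alternate. -/
theorem exists_hasRootSeq_add (h : Interlaces n α β) (hp : HasRootSeq p n β)
    (hq : HasRootSeq q (n + 1) α) :
    ∃ γ, HasRootSeq (p + q) (n + 1) γ ∧ Interlaces n γ β ∧ ∀ j ≤ n, α j < γ j := by
  have hdeg : (p + q).natDegree ≤ n + 1 :=
    natDegree_add_le_of_degree_le (by simp [hp.natDegree_eq]) hq.natDegree_eq.le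
  have hcoeff : 0 < (-1) ^ (n + 1) * (p + q).coeff (n + 1) := by
    rw [coeff_add, coeff_eq_zero_of_natDegree_lt (by simp [hp.natDegree_eq]), zero_add]
    exact hq.neg_one_pow_mul_coeff_pos
  have hleft (j) (hj : j ≤ n) : 0 < (-1) ^ j * (p + q).eval (α j) := by
    rw [eval_add, hq.eval_eq_zero (by omega), add_zero]
    exact h.neg_one_pow_mul_eval_left_pos hp hj
  have hright (j) (hj : j < n) : 0 < -(-1) ^ j * (p + q).eval (β j) := by
    rw [eval_add, hp.eval_eq_zero hj, zero_add, neg_eq_neg_one_mul, ← pow_succ']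
    exact h.neg_one_pow_mul_eval_right_pos hq hj
  have hexists (j) (hj : j ≤ n) : ∃ z, (α j < z ∧ (j < n → z < β j)) ∧ (p + q).eval z = 0 := by
    rcases hj.lt_or_eq with hj | rfl
    · obtain ⟨z, hz, hz0⟩ := exists_mem_Ioo_eval_eq_zero (h j hj).1 (hleft j hj.le) (hright j hj)
      exact ⟨z, ⟨hz.1, fun _ => hz.2⟩, hz0⟩
    · obtain ⟨M, hM, hsign⟩ := exists_lt_neg_one_pow_mul_eval_pos hdeg hcoeff (α j)
      obtain ⟨z, hz, hz0⟩ := exists_mem_Ioo_eval_eq_zero hM (hleft j le_rfl)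
        (by rwa [neg_eq_neg_one_mul, ← pow_succ'])
      exact ⟨z, ⟨hz.1, fun hj => absurd hj (lt_irrefl j)⟩, hz0⟩
  choose! γ hγ hγ0 using hexists
  have hγβ : Interlaces n γ β := fun j hj =>
    ⟨(hγ j hj.le).2 hj, (h j hj).2.trans (hγ (j + 1) hj).1⟩
  have hmono : StrictMonoOn γ (Iic n) := strictMonoOn_Iic_of_lt_succ fun j hj =>
    (hγβ j hj).1.trans (hγβ j hj).2
  refine ⟨γ, .of_eval_eq_zero (hmono.injOn.mono fun j hj => ?_) hdeg hcoeff fun j hj =>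
    hγ0 j (by omega), hγβ, fun j hj => (hγ j hj).1⟩
  simpa [Nat.lt_succ_iff] using hj

end Interlaces

/-- Three polynomials of degree `n` with positive interlacing zeros
`ζ 2 0 < ζ 1 0 < ζ 0 0 < ζ 2 1 < ζ 1 1 < ζ 0 1 < ⋯`. -/
structure InterlacedTriple (n : ℕ) (p : Fin 3 → ℝ[X]) (ζ : Fin 3 → ℕ → ℝ) : Prop where
  hasRootSeq : ∀ a, HasRootSeq (p a) n (ζ a)
  two_pos : ∀ j < n, 0 < ζ 2 j
  two_lt_one : ∀ j < n, ζ 2 j < ζ 1 j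
  one_lt_zero : ∀ j < n, ζ 1 j < ζ 0 j
  zero_lt_two : ∀ j k, j < k → k < n → ζ 0 j < ζ 2 k

theorem HasRootSeq.exists_interlaces_massless {p₀ p₁ q₂ : ℝ[X]} {μ ζ₀ ζ₁ : ℕ → ℝ}
    (h₀ : HasRootSeq p₀ n ζ₀) (h₁ : HasRootSeq p₁ n ζ₁) (h₂ : HasRootSeq q₂ (n + 1) μ)
    (hμ : Interlaces n μ ζ₀) (hμ₁ : ∀ j < n, μ j < ζ₁ j) (h₁₀ : ∀ j < n, ζ₁ j < ζ₀ j)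
    {ℓ : ℝ} (hℓ : 0 < ℓ) :
    ∃ ν η, HasRootSeq (p₁ + C ℓ * q₂) (n + 1) ν ∧
      HasRootSeq (p₀ + C ℓ * p₁ + C (ℓ ^ 2 / 2) * q₂) (n + 1) η ∧
      (∀ j ≤ n, μ j < ν j) ∧ (∀ j ≤ n, ν j < η j) ∧ ∀ j < n, η j < ζ₀ j := by
  have hμζ₁ : Interlaces n μ ζ₁ := fun j hj => ⟨hμ₁ j hj, (h₁₀ j hj).trans (hμ j hj).2⟩
  obtain ⟨ν, hν, hνζ₁, hμν⟩ := hμζ₁.exists_hasRootSeq_add h₁ (h₂.const_mul hℓ)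
  obtain ⟨ρ, hρ, hρζ₁, hνρ⟩ := hνζ₁.exists_hasRootSeq_add h₁ hν
  have hρζ₀ : Interlaces n ρ ζ₀ := fun j hj => ⟨(hρζ₁ j hj).1.trans (h₁₀ j hj),
    (hμ j hj).2.trans ((hμν (j + 1) hj).trans (hνρ (j + 1) hj))⟩
  obtain ⟨η, hη, hηζ₀, hρη⟩ := hρζ₀.exists_hasRootSeq_add h₀ (hρ.const_mul (half_pos hℓ))
  have htaylor : p₀ + C (ℓ / 2) * (p₁ + (p₁ + C ℓ * q₂)) =
      p₀ + C ℓ * p₁ + C (ℓ ^ 2 / 2) * q₂ := by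
    have hhalf : (C ℓ : ℝ[X]) = C (ℓ / 2) + C (ℓ / 2) := by rw [← C_add, add_halves]
    have hsq : (C (ℓ ^ 2 / 2) : ℝ[X]) = C (ℓ / 2) * C ℓ := by rw [← C_mul]; congr 1; ring
    rw [hsq]
    linear_combination (-p₁) * hhalf
  exact ⟨ν, η, hν, htaylor ▸ hη, hμν, fun j hj => (hνρ j hj).trans (hρη j hj),
    fun j hj => (hηζ₀ j hj).1⟩

namespace InterlacedTriple

variable {p q : Fin 3 → ℝ[X]} {ζ : Fin 3 → ℕ → ℝ}

theorem pos (h : InterlacedTriple n p ζ) (a : Fin 3) {j : ℕ} (hj : j < n) : 0 < ζ a j := by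
  have := h.two_pos j hj
  have := h.two_lt_one j hj
  have := h.one_lt_zero j hj
  fin_cases a <;> simp only [Fin.zero_eta, Fin.mk_one, Fin.reduceFinMk] <;> linarith

theorem lt (h : InterlacedTriple n p ζ) (a : Fin 3) {j k : ℕ} (hjk : j < k) (hk : k < n) :
    ζ a j < ζ a k := by
  have := h.zero_lt_two j k hjk hk
  have := h.two_lt_one j (hjk.trans hk)
  have := h.one_lt_zero j (hjk.trans hk)
  have := h.two_lt_one k hk
  have := h.one_lt_zero k hk
  fin_cases a <;> simp only [Fin.zero_eta, Fin.mk_one, Fin.reduceFinMk] <;> linarith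

theorem injOn (h : InterlacedTriple n p ζ) (a : Fin 3) : InjOn (ζ a) (Finset.range n) := by
  rw [Finset.coe_range]
  exact StrictMonoOn.injOn fun _ _ _ hk hjk => h.lt a hjk hk

theorem interlaces (h : InterlacedTriple n p ζ) :
    Interlaces n (fun j => j.casesOn 0 (ζ 0)) (ζ 2)
  | 0, hj => ⟨h.two_pos 0 hj, (h.two_lt_one 0 hj).trans (h.one_lt_zero 0 hj)⟩
  | j + 1, hj => ⟨h.zero_lt_two j (j + 1) j.lt_succ_self hj,
      (h.two_lt_one _ hj).trans (h.one_lt_zero _ hj)⟩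

/-- The effect on the jet of the solution, as a function of the spectral parameter, of a mass `g`
followed by a massless interval of length `ℓ`. -/
theorem exists_succ (h : InterlacedTriple n p ζ) {g ℓ : ℝ} (hg : 0 < g) (hℓ : 0 < ℓ)
    (h₂ : q 2 = p 2 - C g * X * p 0) (h₁ : q 1 = p 1 + C ℓ * q 2)
    (h₀ : q 0 = p 0 + C ℓ * p 1 + C (ℓ ^ 2 / 2) * q 2) :
    ∃ ζ', InterlacedTriple (n + 1) q ζ' := by
  obtain ⟨μ, hμ, hμζ₂, hζ₀μ⟩ := h.interlaces.exists_hasRootSeq_add (h.hasRootSeq 2)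
    ((h.hasRootSeq 0).neg_X_mul.const_mul hg)
  have hμ : HasRootSeq (q 2) (n + 1) μ := by
    convert hμ using 1
    rw [h₂]
    ring
  have hμζ₁ (j) (hj : j < n) : μ j < ζ 1 j := (hμζ₂ j hj).1.trans (h.two_lt_one j hj)
  have hμζ₀ : Interlaces n μ (ζ 0) := fun j hj =>
    ⟨(hμζ₁ j hj).trans (h.one_lt_zero j hj), hζ₀μ (j + 1) hj⟩
  obtain ⟨ν, η, hν, hη, hμν, hνη, hηζ₀⟩ := (h.hasRootSeq 0).exists_interlaces_massless
    (h.hasRootSeq 1) hμ hμζ₀ hμζ₁ h.one_lt_zero hℓ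
  have hμ0 : 0 < μ 0 := hζ₀μ 0 n.zero_le
  have hμpos : ∀ j ≤ n, 0 < μ j
    | 0, _ => hμ0
    | j + 1, hj => (h.pos 0 hj).trans (hμζ₀ j hj).2
  refine ⟨![η, ν, μ], ?_, fun j hj => hμpos j (by omega), fun j hj => hμν j (by omega),
    fun j hj => hνη j (by omega), fun j k hjk hk => ?_⟩
  · rw [← h₁] at hν
    rw [← h₀] at hη
    exact Fin.forall_fin_succ.2 ⟨hη, Fin.forall_fin_two.2 ⟨hν, hμ⟩⟩
  · exact (hηζ₀ j (by omega)).trans (hμζ₀.right_lt_left hjk (by omega))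

end InterlacedTriple

theorem linearIndependent_eval_of_degree_eq {K : Type*} [Field K] {P : Fin n → K[X]}
    (hP : ∀ i, (P i).degree = (i : ℕ)) {v : Fin n → K} (hv : Function.Injective v) :
    LinearIndependent K fun j i => (P i).eval (v j) := by
  have hP0 (i) : (P i).leadingCoeff ≠ 0 :=
    leadingCoeff_ne_zero.2 fun h => by simpa [h] using hP i
  have hdet := Matrix.det_eval_matrixOfPolynomials_eq_det_vandermonde v
    (fun i => C (P i).leadingCoeff⁻¹ * P i)
    (fun i => by rw [natDegree_C_mul (inv_ne_zero (hP0 i)), natDegree_eq_of_degree_eq_some (hP i)])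
    (fun i => monic_C_mul_of_mul_leadingCoeff_eq_one (inv_mul_cancel₀ (hP0 i)))
  have hrows := Matrix.linearIndependent_rows_of_det_ne_zero
    (hdet ▸ Matrix.det_vandermonde_ne_zero_iff.2 hv)
  let normalize : (Fin n → K) →ₗ[K] Fin n → K :=
    LinearMap.pi fun i => (P i).leadingCoeff⁻¹ • LinearMap.proj i
  have hnormalize : (normalize ∘ fun j i => (P i).eval (v j)) =
      (Matrix.of fun j i => (C (P i).leadingCoeff⁻¹ * P i).eval (v j)).row := by
    ext j i
    simp [normalize, Matrix.row]
  exact .of_comp normalize (hnormalize ▸ hrows)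

end RealRootedPolynomials

section StringPolynomials

open Polynomial

/-- The derivative of order `a` of `s ↦ s ^ 2 / 2`, the fundamental solution of `f''' = 0`. -/
noncomputable def halfSq (a : Fin 3) (s : ℝ) : ℝ :=
  ![s ^ 2 / 2, s, 1] a

theorem halfSq_zero (s : ℝ) : halfSq 0 s = s ^ 2 / 2 := rfl

theorem halfSq_one (s : ℝ) : halfSq 1 s = s := rfl

theorem halfSq_two (s : ℝ) : halfSq 2 s = 1 := rfl

/-- The derivative of order `a` at `t` of the solution of the initial value problem with only the
first `k` of the masses `g` at the points `x`, continued analytically to the right of these, as a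
polynomial in the spectral parameter. -/
noncomputable def stringPoly (g x : ℕ → ℝ) : ℕ → Fin 3 → ℝ → ℝ[X]
  | 0, a, t => C (halfSq a t)
  | k + 1, a, t =>
    stringPoly g x k a t - C (g k * halfSq a (t - x k)) * (X * stringPoly g x k 0 (x k))

/-- The value at the `k`-th mass of the solution of the initial value problem, as a polynomial in
the spectral parameter. -/
noncomputable def nodalPoly (g x : ℕ → ℝ) (k : ℕ) : ℝ[X] :=
  stringPoly g x k 0 (x k)

variable {g x : ℕ → ℝ}

theorem stringPoly_zero (a : Fin 3) (t : ℝ) : stringPoly g x 0 a t = C (halfSq a t) := rfl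

theorem stringPoly_succ (k : ℕ) (a : Fin 3) (t : ℝ) :
    stringPoly g x (k + 1) a t =
      stringPoly g x k a t - C (g k * halfSq a (t - x k)) * (X * nodalPoly g x k) := rfl

theorem stringPoly_two_eq (k : ℕ) (s t : ℝ) :
    stringPoly g x k 2 t = stringPoly g x k 2 s := by
  induction k with
  | zero => rfl
  | succ k ih => simp only [stringPoly_succ, ih, halfSq_two]

theorem stringPoly_one_eq (k : ℕ) (s t : ℝ) :
    stringPoly g x k 1 t = stringPoly g x k 1 s + C (t - s) * stringPoly g x k 2 s := by
  induction k with
  | zero => simp [stringPoly_zero, halfSq_one, halfSq_two]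
  | succ k ih =>
    simp only [stringPoly_succ, ih, halfSq_one, halfSq_two, C_mul, C_sub, C_1]
    ring

theorem stringPoly_zero_eq (k : ℕ) (s t : ℝ) :
    stringPoly g x k 0 t = stringPoly g x k 0 s + C (t - s) * stringPoly g x k 1 s +
      C ((t - s) ^ 2 / 2) * stringPoly g x k 2 s := by
  have htaylor (y : ℝ) : halfSq 0 (t - y) = halfSq 0 (s - y) + (t - s) * halfSq 1 (s - y) +
      (t - s) ^ 2 / 2 * halfSq 2 (s - y) := by
    simp only [halfSq_zero, halfSq_one, halfSq_two]
    ring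
  induction k with
  | zero => simpa only [stringPoly_zero, sub_zero, ← C_mul, ← C_add] using congrArg C (htaylor 0)
  | succ k ih =>
    simp only [stringPoly_succ, ih, htaylor, C_mul, C_add]
    ring

theorem exists_interlacedTriple_stringPoly (k : ℕ) (hg : ∀ j < k, 0 < g j)
    (hx0 : ∀ j < k, 0 < x j) (hx : ∀ i j, i < j → j < k → x i < x j) {t : ℝ} (ht0 : 0 < t)
    (ht : ∀ j < k, x j < t) : ∃ ζ, InterlacedTriple k (fun a => stringPoly g x k a t) ζ := by
  induction k generalizing t with
  | zero =>
    refine ⟨0, fun a => ⟨halfSq a t, ?_, by simp [stringPoly_zero]⟩, by simp, by simp, by simp,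
      by simp⟩
    fin_cases a <;> simp [halfSq, ht0]
  | succ k ih =>
    obtain ⟨ζ, hζ⟩ := ih (fun j hj => hg j (by omega)) (fun j hj => hx0 j (by omega))
      (fun i j hij hj => hx i j hij (by omega)) (hx0 k k.lt_succ_self)
      (fun j hj => hx j k hj k.lt_succ_self)
    refine hζ.exists_succ (hg k k.lt_succ_self) (sub_pos.2 (ht k k.lt_succ_self)) ?_ ?_ ?_
    · rw [stringPoly_succ, stringPoly_two_eq k (x k) t, halfSq_two, nodalPoly, mul_one, mul_assoc]
    · simp [stringPoly_one_eq (k + 1) (x k) t, stringPoly_two_eq (k + 1) (x k) t,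
        stringPoly_succ k 1, halfSq_one]
    · simp [stringPoly_zero_eq (k + 1) (x k) t, stringPoly_two_eq (k + 1) (x k) t,
        stringPoly_succ k 1, stringPoly_succ k 0, halfSq_zero, halfSq_one]

/-- The right hand side is the concomitant `φ' ψ' - φ'' ψ - φ ψ''`: it is constant on massless
intervals and vanishes at `0`, so only the jumps of `φ''` and `ψ''` at the masses contribute. -/
theorem lagrange_identity (z w : ℂ) (k : ℕ) (t : ℝ) :
    (z + w) * ∑ j ∈ Finset.range k,
        (g j : ℂ) * (aeval z (nodalPoly g x j) * aeval w (nodalPoly g x j)) =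
      aeval z (stringPoly g x k 1 t) * aeval w (stringPoly g x k 1 t) -
        aeval z (stringPoly g x k 2 t) * aeval w (stringPoly g x k 0 t) -
        aeval z (stringPoly g x k 0 t) * aeval w (stringPoly g x k 2 t) := by
  induction k generalizing t with
  | zero =>
    simp only [Finset.range_zero, Finset.sum_empty, mul_zero, stringPoly_zero, halfSq_zero,
      halfSq_one, halfSq_two, aeval_C, map_one, Complex.coe_algebraMap, Complex.ofReal_div,
      Complex.ofReal_pow, Complex.ofReal_ofNat]
    ring
  | succ k ih =>
    rw [stringPoly_zero_eq _ (x k) t, stringPoly_two_eq _ (x k) t, stringPoly_one_eq _ (x k) t,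
      stringPoly_succ, stringPoly_succ, stringPoly_succ, Finset.sum_range_succ, mul_add,
      ih (x k), nodalPoly]
    simp only [halfSq_zero, halfSq_one, halfSq_two, map_add, map_sub, map_mul, map_zero,
      aeval_C, aeval_X, Complex.coe_algebraMap, Complex.ofReal_div, Complex.ofReal_pow,
      Complex.ofReal_sub, Complex.ofReal_ofNat, sub_self, mul_zero, mul_one, zero_div, ne_eq,
      OfNat.ofNat_ne_zero, not_false_eq_true, zero_pow]
    ring

theorem aeval_stringPoly (z : ℂ) (k : ℕ) (a : Fin 3) (t : ℝ) :
    aeval z (stringPoly g x k a t) = (halfSq a t : ℂ) - z * ∑ j ∈ Finset.range k,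
      (g j : ℂ) * aeval z (nodalPoly g x j) * (halfSq a (t - x j) : ℂ) := by
  induction k with
  | zero => simp [stringPoly_zero]
  | succ k ih =>
    rw [stringPoly_succ, map_sub, ih, Finset.sum_range_succ]
    simp only [map_mul, aeval_C, Complex.coe_algebraMap, aeval_X]
    ring

end StringPolynomials

section TestFunctions

theorem exists_Icc_of_isCompact_subset_Ioo {a b : ℝ} (hab : a < b) {K : Set ℝ}
    (hK : IsCompact K) (hKab : K ⊆ Ioo a b) : ∃ c d, a < c ∧ d < b ∧ K ⊆ Icc c d := by
  obtain ⟨m, hm⟩ := exists_between hab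
  have hK' : IsCompact (insert m K) := hK.insert m
  have hne : (insert m K).Nonempty := insert_nonempty m K
  have hsub : insert m K ⊆ Ioo a b := insert_subset hm hKab
  exact ⟨sInf (insert m K), sSup (insert m K), (hsub (hK'.sInf_mem hne)).1,
    (hsub (hK'.sSup_mem hne)).2,
    (subset_insert m K).trans (subset_Icc_csInf_csSup hK'.bddBelow hK'.bddAbove)⟩

/-- Real test functions on the open interval `(a, b)`, as functions on the line. -/
structure IsTestFunction (a b : ℝ) (ψ : ℝ → ℝ) : Prop where
  contDiff : ContDiff ℝ (⊤ : ℕ∞) ψ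
  hasCompactSupport : HasCompactSupport ψ
  tsupport_subset : tsupport ψ ⊆ Ioo a b

variable {a b : ℝ} {ψ χ θ : ℝ → ℝ} {f : ℝ → ℂ}

namespace IsTestFunction

protected theorem deriv (h : IsTestFunction a b ψ) : IsTestFunction a b (deriv ψ) :=
  ⟨(contDiff_infty_iff_deriv.1 h.contDiff).2, h.hasCompactSupport.deriv,
    tsupport_deriv_subset.trans h.tsupport_subset⟩

protected theorem iteratedDeriv (h : IsTestFunction a b ψ) (k : ℕ) :
    IsTestFunction a b (iteratedDeriv k ψ) := by
  induction k with
  | zero => rwa [iteratedDeriv_zero]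
  | succ k ih => rw [iteratedDeriv_succ]; exact ih.deriv

protected theorem contDiffAt (h : IsTestFunction a b ψ) (k : ℕ) (t : ℝ) : ContDiffAt ℝ k ψ t :=
  (h.contDiff.of_le (by exact_mod_cast le_top)).contDiffAt

theorem hasDerivAt (h : IsTestFunction a b ψ) (t : ℝ) : HasDerivAt ψ (deriv ψ t) t :=
  ((contDiff_infty_iff_deriv.1 h.contDiff).1 t).hasDerivAt

protected theorem continuous (h : IsTestFunction a b ψ) : Continuous ψ :=
  h.contDiff.continuous

theorem eq_zero (h : IsTestFunction a b ψ) {t : ℝ} (ht : t ∉ Ioo a b) : ψ t = 0 :=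
  image_eq_zero_of_notMem_tsupport fun ht' => ht (h.tsupport_subset ht')

theorem left_eq_zero (h : IsTestFunction a b ψ) : ψ a = 0 :=
  h.eq_zero left_notMem_Ioo

theorem right_eq_zero (h : IsTestFunction a b ψ) : ψ b = 0 :=
  h.eq_zero right_notMem_Ioo

theorem intervalIntegral_eq_integral (h : IsTestFunction a b ψ) :
    ∫ t in a..b, ψ t = ∫ t, ψ t :=
  intervalIntegral.integral_eq_integral_of_support_subset
    ((subset_tsupport ψ).trans (h.tsupport_subset.trans Ioo_subset_Ioc_self))

protected theorem sub (hψ : IsTestFunction a b ψ) (hθ : IsTestFunction a b θ) :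
    IsTestFunction a b (ψ - θ) :=
  ⟨hψ.contDiff.sub hθ.contDiff, hψ.hasCompactSupport.sub hθ.hasCompactSupport,
    (tsupport_sub _ _).trans (union_subset hψ.tsupport_subset hθ.tsupport_subset)⟩

theorem const_smul (h : IsTestFunction a b ψ) (c : ℝ) : IsTestFunction a b (c • ψ) :=
  ⟨contDiff_const.smul h.contDiff, h.hasCompactSupport.smul_left (f := fun _ => c),
    (closure_mono (Function.support_const_smul_subset c ψ)).trans h.tsupport_subset⟩

theorem exists_integral_eq_one (hab : a < b) :
    ∃ θ, IsTestFunction a b θ ∧ ∫ t in a..b, θ t = 1 := by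
  let bump : ContDiffBump ((a + b) / 2) := ⟨(b - a) / 8, (b - a) / 4, by linarith, by linarith⟩
  have h : IsTestFunction a b (bump.normed volume) := by
    refine ⟨bump.contDiff_normed, bump.hasCompactSupport_normed, ?_⟩
    rw [bump.tsupport_normed_eq, Real.closedBall_eq_Icc]
    exact Icc_subset_Ioo (by simp only [bump]; linarith) (by simp only [bump]; linarith)
  exact ⟨_, h, h.intervalIntegral_eq_integral.trans bump.integral_normed⟩

theorem exists_deriv_eq (hab : a < b) (h : IsTestFunction a b χ)
    (hχ : ∫ t in a..b, χ t = 0) : ∃ ψ, IsTestFunction a b ψ ∧ deriv ψ = χ := by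
  let ψ (s : ℝ) : ℝ := ∫ t in a..s, χ t
  have hψ (s : ℝ) : HasDerivAt ψ (χ s) s :=
    intervalIntegral.integral_hasDerivAt_right (h.continuous.intervalIntegrable _ _)
      h.continuous.stronglyMeasurable.stronglyMeasurableAtFilter h.continuous.continuousAt
  have hderiv : deriv ψ = χ := funext fun s => (hψ s).deriv
  obtain ⟨c, d, hac, hdb, hcd⟩ :=
    exists_Icc_of_isCompact_subset_Ioo hab h.hasCompactSupport h.tsupport_subset
  have hsupport : Function.support χ ⊆ Icc c d := (subset_tsupport χ).trans hcd
  have hψsupport : Function.support ψ ⊆ Icc c d := by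
    refine Function.support_subset_iff'.2 fun s hs => ?_
    rcases lt_or_ge s c with hsc | hcs
    · refine (intervalIntegral.integral_congr fun t ht => ?_).trans intervalIntegral.integral_zero
      exact Function.support_subset_iff'.1 hsupport t fun htc =>
        (htc.1.trans ht.2).not_gt (max_lt hac hsc)
    · have hds : d < s := lt_of_not_ge fun hsd => hs ⟨hcs, hsd⟩
      rw [← hχ, h.intervalIntegral_eq_integral]
      exact intervalIntegral.integral_eq_integral_of_support_subset
        (hsupport.trans fun t ht => ⟨hac.trans_le ht.1, ht.2.trans hds.le⟩)
  exact ⟨ψ, ⟨contDiff_infty_iff_deriv.2 ⟨fun s => (hψ s).differentiableAt, hderiv ▸ h.contDiff⟩,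
    .of_support_subset_isCompact isCompact_Icc hψsupport,
    (closure_minimal hψsupport isClosed_Icc).trans (Icc_subset_Ioo hac hdb)⟩, hderiv⟩

theorem exists_eq_deriv_add_integral_smul (hab : a < b) :
    ∃ θ, IsTestFunction a b θ ∧ ∀ χ, IsTestFunction a b χ →
      ∃ ψ, IsTestFunction a b ψ ∧ χ = deriv ψ + (∫ t in a..b, χ t) • θ := by
  obtain ⟨θ, hθ, hθ1⟩ := exists_integral_eq_one hab
  refine ⟨θ, hθ, fun χ hχ => ?_⟩
  obtain ⟨ψ, hψ, hderiv⟩ := (hχ.sub (hθ.const_smul (∫ t in a..b, χ t))).exists_deriv_eq hab (by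
    simp only [Pi.sub_apply, Pi.smul_apply, smul_eq_mul]
    rw [intervalIntegral.integral_sub (hχ.continuous.intervalIntegrable _ _)
      ((hθ.continuous.const_mul _).intervalIntegrable _ _),
      intervalIntegral.integral_const_mul, hθ1, mul_one, sub_self])
  exact ⟨ψ, hψ, by rw [hderiv, sub_add_cancel]⟩

theorem integral_pow_succ_mul_deriv (h : IsTestFunction a b ψ) (k : ℕ) :
    ∫ t in a..b, t ^ (k + 1) * deriv ψ t = -((k + 1) * ∫ t in a..b, t ^ k * ψ t) := by
  rw [intervalIntegral.integral_mul_deriv_eq_deriv_mul (u' := fun t => (k + 1) * t ^ k)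
    (fun t _ => by simpa using hasDerivAt_pow (k + 1) t) (fun t _ => h.hasDerivAt t)
    (Continuous.intervalIntegrable (by fun_prop) _ _) (h.deriv.continuous.intervalIntegrable _ _),
    h.left_eq_zero, h.right_eq_zero, ← intervalIntegral.integral_const_mul]
  simp [mul_assoc]

theorem integral_pow_mul_iteratedDeriv (h : IsTestFunction a b ψ) (k : ℕ) :
    ∫ t in a..b, t ^ k * iteratedDeriv k ψ t =
      (-1) ^ k * k.factorial * ∫ t in a..b, ψ t := by
  induction k with
  | zero => simp
  | succ k ih =>
    rw [iteratedDeriv_succ, (h.iteratedDeriv k).integral_pow_succ_mul_deriv, ih]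
    push_cast [Nat.factorial_succ]
    ring

end IsTestFunction

theorem intervalIntegrable_mul_ofReal (hab : a < b) (hf : ContinuousOn f (Icc a b))
    (hψ : Continuous ψ) : IntervalIntegrable (fun t => f t * (ψ t : ℂ)) volume a b := by
  refine ContinuousOn.intervalIntegrable ?_
  rw [uIcc_of_le hab.le]
  exact hf.mul (Complex.continuous_ofReal.comp hψ).continuousOn

theorem eqOn_zero_of_integral_mul_isTestFunction_eq_zero (hab : a < b)
    (hf : ContinuousOn f (Icc a b))
    (h : ∀ ψ, IsTestFunction a b ψ → ∫ t in a..b, f t * (ψ t : ℂ) = 0) :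
    EqOn f 0 (Icc a b) := by
  have hae : ∀ᵐ t : ℝ, t ∈ Ioo a b → f t = 0 := by
    refine isOpen_Ioo.ae_eq_zero_of_integral_contDiff_smul_eq_zero
      ((hf.mono Ioo_subset_Icc_self).locallyIntegrableOn measurableSet_Ioo) fun ψ h1 h2 h3 => ?_
    rw [← h ψ ⟨h1, h2, h3⟩, intervalIntegral.integral_eq_integral_of_support_subset]
    · simp only [Complex.real_smul, mul_comm]
    · refine (Function.support_mul_subset_right _ _).trans ?_
      refine Function.support_subset_iff'.2 fun t ht => ?_
      exact_mod_cast image_eq_zero_of_notMem_tsupport fun ht' => ht (Ioo_subset_Ioc_self (h3 ht'))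
  refine Measure.eqOn_Icc_of_ae_eq volume hab.ne ?_ hf continuousOn_const
  rw [← restrict_Ioo_eq_restrict_Icc, Filter.EventuallyEq, ae_restrict_iff' measurableSet_Ioo]
  exact hae

theorem exists_integral_mul_iteratedDeriv_eq (hab : a < b) (hf : ContinuousOn f (Icc a b))
    {k : ℕ} (h : ∀ ψ, IsTestFunction a b ψ →
      ∫ t in a..b, f t * ((iteratedDeriv (k + 1) ψ t : ℝ) : ℂ) = 0) :
    ∃ c : ℂ, ∀ χ, IsTestFunction a b χ →
      ∫ t in a..b, f t * ((iteratedDeriv k χ t : ℝ) : ℂ) = c * (∫ t in a..b, χ t : ℝ) := by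
  obtain ⟨θ, hθ, hdecomp⟩ := IsTestFunction.exists_eq_deriv_add_integral_smul hab
  refine ⟨∫ t in a..b, f t * ((iteratedDeriv k θ t : ℝ) : ℂ), fun χ hχ => ?_⟩
  obtain ⟨ψ, hψ, hχψ⟩ := hdecomp χ hχ
  set m := ∫ t in a..b, χ t
  have hint (ρ) (hρ : IsTestFunction a b ρ) (j : ℕ) :=
    intervalIntegrable_mul_ofReal hab hf (hρ.iteratedDeriv j).continuous
  calc ∫ t in a..b, f t * ((iteratedDeriv k χ t : ℝ) : ℂ)
      = ∫ t in a..b, (f t * ((iteratedDeriv (k + 1) ψ t : ℝ) : ℂ) +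
          m * (f t * ((iteratedDeriv k θ t : ℝ) : ℂ))) := by
        refine intervalIntegral.integral_congr fun t _ => ?_
        rw [hχψ, iteratedDeriv_add (hψ.deriv.contDiffAt k t) ((hθ.const_smul m).contDiffAt k t),
          iteratedDeriv_const_smul (hθ.contDiffAt k t), ← iteratedDeriv_succ', smul_eq_mul]
        push_cast
        ring
    _ = (∫ t in a..b, f t * ((iteratedDeriv k θ t : ℝ) : ℂ)) * m := by
        rw [intervalIntegral.integral_add (hint ψ hψ (k + 1)) ((hint θ hθ k).const_mul _),
          h ψ hψ, intervalIntegral.integral_const_mul, zero_add, mul_comm]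

theorem exists_eqOn_eval_of_integral_mul_iteratedDeriv_eq_zero (hab : a < b) (k : ℕ)
    (hf : ContinuousOn f (Icc a b))
    (h : ∀ ψ, IsTestFunction a b ψ → ∫ t in a..b, f t * ((iteratedDeriv k ψ t : ℝ) : ℂ) = 0) :
    ∃ P : Polynomial ℂ, P.degree < k ∧ EqOn f (fun t => P.eval (t : ℂ)) (Icc a b) := by
  induction k generalizing f with
  | zero =>
    refine ⟨0, by simp, fun t ht => ?_⟩
    simpa using eqOn_zero_of_integral_mul_isTestFunction_eq_zero hab hf (by simpa using h) ht
  | succ k ih =>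
    obtain ⟨c, hc⟩ := exists_integral_mul_iteratedDeriv_eq hab hf h
    set d : ℂ := c / ((-1) ^ k * k.factorial)
    have hdc : d * ((-1) ^ k * k.factorial) = c :=
      div_mul_cancel₀ _ (by simp [k.factorial_ne_zero])
    obtain ⟨P, hP, hfP⟩ := ih (f := fun t => f t - d * (t : ℂ) ^ k) (hf.sub (by fun_prop)) (by
      intro ψ hψ
      have hψk := (hψ.iteratedDeriv k).continuous
      have hmoment : ∫ t in a..b, (t : ℂ) ^ k * ((iteratedDeriv k ψ t : ℝ) : ℂ) =
          (-1) ^ k * k.factorial * (∫ t in a..b, ψ t : ℝ) := by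
        simp_rw [← Complex.ofReal_pow, ← Complex.ofReal_mul]
        rw [intervalIntegral.integral_ofReal, hψ.integral_pow_mul_iteratedDeriv]
        push_cast
        rfl
      simp only [sub_mul, mul_assoc]
      rw [intervalIntegral.integral_sub (intervalIntegrable_mul_ofReal hab hf hψk)
        ((intervalIntegrable_mul_ofReal hab (by fun_prop) hψk).const_mul _),
        intervalIntegral.integral_const_mul, hmoment, hc ψ hψ, ← hdc]
      ring)
    refine ⟨P + Polynomial.C d * Polynomial.X ^ k, ?_, fun t ht => ?_⟩
    · refine (Polynomial.degree_add_le _ _).trans_lt (max_lt (hP.trans ?_)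
        ((Polynomial.degree_C_mul_X_pow_le k d).trans_lt ?_)) <;>
      exact_mod_cast k.lt_succ_self
    · simpa [sub_eq_iff_eq_add] using hfP ht

/-- The truncated power `(s₊)² / 2`, the causal fundamental solution of `f''' = δ`. -/
noncomputable def truncSq (s : ℝ) : ℝ := halfSq 0 (max s 0)

theorem truncSq_of_nonneg {s : ℝ} (hs : 0 ≤ s) : truncSq s = halfSq 0 s := by
  rw [truncSq, max_eq_left hs]

theorem truncSq_of_nonpos {s : ℝ} (hs : s ≤ 0) : truncSq s = 0 := by
  simp [truncSq, max_eq_right hs, halfSq_zero]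

theorem continuous_truncSq : Continuous truncSq := by
  unfold truncSq
  simp only [halfSq_zero]
  fun_prop

namespace IsTestFunction

theorem integral_halfSq_mul (h : IsTestFunction a b ψ) (y : ℝ) :
    ∫ t in y..b, halfSq 0 (t - y) * iteratedDeriv 3 ψ t = -ψ y := by
  have hderiv (k : ℕ) (t : ℝ) :
      HasDerivAt (iteratedDeriv k ψ) (iteratedDeriv (k + 1) ψ t) t := by
    rw [iteratedDeriv_succ]
    exact (h.iteratedDeriv k).hasDerivAt t
  have hprimitive (t : ℝ) : HasDerivAt (fun t => (t - y) ^ 2 / 2 * iteratedDeriv 2 ψ t -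
      (t - y) * iteratedDeriv 1 ψ t + iteratedDeriv 0 ψ t)
      (halfSq 0 (t - y) * iteratedDeriv 3 ψ t) t := by
    have hsub : HasDerivAt (fun t => t - y) 1 t := (hasDerivAt_id t).sub_const y
    refine (((((hsub.pow 2).div_const 2).mul (hderiv 2 t)).sub
      (hsub.mul (hderiv 1 t))).add (hderiv 0 t)).congr_deriv ?_
    simp only [halfSq_zero, Pi.pow_apply, Nat.cast_ofNat, Nat.add_one_sub_one, pow_one, mul_one,
      one_mul, zero_add, Nat.reduceAdd]
    ring
  rw [intervalIntegral.integral_eq_sub_of_hasDerivAt (fun t _ => hprimitive t),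
    (h.iteratedDeriv 2).right_eq_zero, (h.iteratedDeriv 1).right_eq_zero,
    (h.iteratedDeriv 0).right_eq_zero]
  · simp
  · simp only [halfSq_zero]
    exact ((by fun_prop : Continuous fun t => (t - y) ^ 2 / 2).mul
      (h.iteratedDeriv 3).continuous).intervalIntegrable _ _

theorem integral_truncSq_mul (h : IsTestFunction a b ψ) {y : ℝ} (hy : y ∈ Icc a b) :
    ∫ t in a..b, truncSq (t - y) * iteratedDeriv 3 ψ t = -ψ y := by
  have hcont : Continuous fun t => truncSq (t - y) * iteratedDeriv 3 ψ t :=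
    (continuous_truncSq.comp (by fun_prop)).mul (h.iteratedDeriv 3).continuous
  have hleft : ∫ t in a..y, truncSq (t - y) * iteratedDeriv 3 ψ t = 0 := by
    refine (intervalIntegral.integral_congr fun t ht => ?_).trans intervalIntegral.integral_zero
    rw [uIcc_of_le hy.1] at ht
    simp only [truncSq_of_nonpos (sub_nonpos.2 ht.2), zero_mul]
  rw [← intervalIntegral.integral_add_adjacent_intervals (hcont.intervalIntegrable a y)
    (hcont.intervalIntegrable y b), hleft, zero_add, ← h.integral_halfSq_mul y]
  refine intervalIntegral.integral_congr fun t ht => ?_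
  rw [uIcc_of_le hy.2] at ht
  simp only [truncSq_of_nonneg (sub_nonneg.2 ht.1)]

end IsTestFunction

end TestFunctions

theorem stringDeriv_of_eventuallyEq {f : ℝ → ℂ} {t : ℝ} (ht : t ∈ Icc (0 : ℝ) 1)
    {A : Fin 3 → ℂ} (h : f =ᶠ[nhdsWithin t (Icc 0 1)]
      fun s => A 0 + A 1 * ((s - t : ℝ) : ℂ) + A 2 * ((s - t : ℝ) : ℂ) ^ 2 / 2) (a : Fin 3) :
    stringDeriv a f t = A a := by
  have hsub (s : ℝ) : HasDerivAt (fun s : ℝ => ((s - t : ℝ) : ℂ)) 1 s := by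
    simpa using ((hasDerivAt_id s).sub_const t).ofReal_comp
  have hcont (k : ℕ) : ContDiff ℝ k fun s : ℝ => ((s - t : ℝ) : ℂ) :=
    Complex.ofRealCLM.contDiff.comp (contDiff_id.sub contDiff_const)
  have hderiv₁ : deriv (fun s : ℝ => A 0 + A 1 * ((s - t : ℝ) : ℂ) +
      A 2 * ((s - t : ℝ) : ℂ) ^ 2 / 2) = fun s : ℝ => A 1 + A 2 * ((s - t : ℝ) : ℂ) := by
    funext s
    refine (((((hsub s).const_mul (A 1)).const_add (A 0)).add
      ((((hsub s).pow 2).const_mul (A 2)).div_const 2)).congr_deriv ?_).deriv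
    simp only [Nat.cast_ofNat, Nat.add_one_sub_one, pow_one, mul_one]
    ring
  have hderiv₂ : deriv (fun s : ℝ => A 1 + A 2 * ((s - t : ℝ) : ℂ)) = fun _ => A 2 :=
    funext fun s => ((((hsub s).const_mul (A 2)).const_add (A 1)).congr_deriv (mul_one _)).deriv
  rw [stringDeriv, h.iteratedDerivWithin_eq (h.self_of_nhdsWithin ht),
    iteratedDerivWithin_eq_iteratedDeriv (uniqueDiffOn_Icc zero_lt_one)
      (((contDiff_const.add (contDiff_const.mul (hcont a))).add
        ((contDiff_const.mul ((hcont a).pow 2)).div_const 2)).contDiffAt) ht]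
  fin_cases a
  · simp
  · change iteratedDeriv 1 _ t = A 1
    rw [iteratedDeriv_one, hderiv₁]
    simp
  · change iteratedDeriv 2 _ t = A 2
    rw [iteratedDeriv_succ, iteratedDeriv_one, hderiv₁, hderiv₂]

namespace DiscreteCubicString

open Polynomial

variable {n : ℕ} (S : DiscreteCubicString n)

/-- The masses, extended by zero to a sequence. -/
noncomputable def gSeq (k : ℕ) : ℝ := if h : k < n then S.g ⟨k, h⟩ else 0

/-- The positions of the masses, extended by zero to a sequence. -/
noncomputable def xSeq (k : ℕ) : ℝ := if h : k < n then S.x ⟨k, h⟩ else 0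

theorem gSeq_pos {k : ℕ} (hk : k < n) : 0 < S.gSeq k := by
  rw [gSeq, dif_pos hk]
  exact S.g_pos _

theorem xSeq_mem {k : ℕ} (hk : k < n) : S.xSeq k ∈ Ioo (0 : ℝ) 1 := by
  rw [xSeq, dif_pos hk]
  exact S.x_mem _

theorem xSeq_mem_Icc {k : ℕ} (hk : k < n) : S.xSeq k ∈ Icc (0 : ℝ) 1 :=
  Ioo_subset_Icc_self (S.xSeq_mem hk)

theorem xSeq_lt {i j : ℕ} (hij : i < j) (hj : j < n) : S.xSeq i < S.xSeq j := by
  rw [xSeq, xSeq, dif_pos hj, dif_pos (hij.trans hj)]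
  exact S.x_strictMono hij

theorem xSeq_le {i j : ℕ} (hij : i ≤ j) (hj : j < n) : S.xSeq i ≤ S.xSeq j :=
  hij.eq_or_lt.elim (fun h => h ▸ le_rfl) fun h => (S.xSeq_lt h hj).le

theorem integral_mass (f : ℝ → ℂ) :
    ∫ ξ, f ξ ∂S.mass = ∑ j ∈ Finset.range n, (S.gSeq j : ℂ) * f (S.xSeq j) := by
  rw [mass, integral_finsetSum_measure, Finset.sum_range]
  · refine Finset.sum_congr rfl fun i _ => ?_
    rw [integral_smul_measure, integral_dirac, ENNReal.toReal_ofReal (S.g_pos i).le, gSeq, xSeq,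
      dif_pos i.2, dif_pos i.2, Complex.real_smul]
  · intro i _
    exact (integrable_dirac (by simp)).smul_measure ENNReal.ofReal_ne_top

theorem of_ae_mass {P : ℝ → Prop} (h : ∀ᵐ ξ ∂S.mass, P ξ) {j : ℕ} (hj : j < n) :
    P (S.xSeq j) := by
  by_contra hP
  rw [xSeq, dif_pos hj] at hP
  rw [ae_iff, mass, Measure.finsetSum_apply, Finset.sum_eq_zero_iff] at h
  have hzero := h ⟨j, hj⟩ (Finset.mem_univ _)
  rw [Measure.smul_apply, Measure.dirac_apply_of_mem (by exact hP), smul_eq_mul, mul_one,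
    ENNReal.ofReal_eq_zero] at hzero
  exact hzero.not_gt (S.g_pos ⟨j, hj⟩)

theorem sum_truncSq_eq {k : ℕ} (hk : k ≤ n) {ξ : ℝ} (hle : ∀ j < k, S.xSeq j ≤ ξ)
    (hge : ∀ j, k ≤ j → j < n → ξ ≤ S.xSeq j) (m : ℕ → ℂ) :
    ∑ j ∈ Finset.range n, m j * (truncSq (ξ - S.xSeq j) : ℂ) =
      ∑ j ∈ Finset.range k, m j * (halfSq 0 (ξ - S.xSeq j) : ℂ) := by
  rw [← Finset.sum_subset (Finset.range_mono hk)]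
  · refine Finset.sum_congr rfl fun j hj => ?_
    rw [truncSq_of_nonneg (sub_nonneg.2 (hle j (Finset.mem_range.1 hj)))]
  · intro j hj hj'
    rw [truncSq_of_nonpos, Complex.ofReal_zero, mul_zero]
    exact sub_nonpos.2 (hge j (by simpa using hj') (Finset.mem_range.1 hj))

theorem continuous_sum_truncSq (m : ℕ → ℂ) :
    Continuous fun ξ : ℝ => ∑ j ∈ Finset.range n, m j * (truncSq (ξ - S.xSeq j) : ℂ) :=
  continuous_finsetSum _ fun _ _ => continuous_const.mul
    (Complex.continuous_ofReal.comp (continuous_truncSq.comp (continuous_sub_right _)))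

theorem integral_sum_truncSq_mul (m : ℕ → ℂ) {ψ : ℝ → ℝ} (h : IsTestFunction 0 1 ψ) :
    ∫ ξ in (0 : ℝ)..1, (∑ j ∈ Finset.range n, m j * (truncSq (ξ - S.xSeq j) : ℂ)) *
        ((iteratedDeriv 3 ψ ξ : ℝ) : ℂ) =
      -∑ j ∈ Finset.range n, m j * (ψ (S.xSeq j) : ℂ) := by
  simp_rw [Finset.sum_mul, mul_assoc, ← Complex.ofReal_mul]
  rw [intervalIntegral.integral_finsetSum, ← Finset.sum_neg_distrib]
  · refine Finset.sum_congr rfl fun j hj => ?_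
    rw [intervalIntegral.integral_const_mul, intervalIntegral.integral_ofReal,
      h.integral_truncSq_mul (S.xSeq_mem_Icc (Finset.mem_range.1 hj)), Complex.ofReal_neg, mul_neg]
  · intro j _
    exact (continuous_const.mul (Complex.continuous_ofReal.comp
      ((continuous_truncSq.comp (continuous_sub_right _)).mul
        (h.iteratedDeriv 3).continuous))).intervalIntegrable _ _

/-- The solution of the initial value problem. -/
noncomputable def solution (z : ℂ) (ξ : ℝ) : ℂ :=
  (halfSq 0 ξ : ℂ) - z * ∑ j ∈ Finset.range n,
    (S.gSeq j : ℂ) * aeval z (nodalPoly S.gSeq S.xSeq j) * (truncSq (ξ - S.xSeq j) : ℂ)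

theorem solution_eq (z : ℂ) {k : ℕ} (hk : k ≤ n) {ξ : ℝ} (hle : ∀ j < k, S.xSeq j ≤ ξ)
    (hge : ∀ j, k ≤ j → j < n → ξ ≤ S.xSeq j) :
    S.solution z ξ = aeval z (stringPoly S.gSeq S.xSeq k 0 ξ) := by
  rw [solution, aeval_stringPoly, S.sum_truncSq_eq hk hle hge]

theorem solution_xSeq (z : ℂ) {k : ℕ} (hk : k < n) :
    S.solution z (S.xSeq k) = aeval z (nodalPoly S.gSeq S.xSeq k) :=
  S.solution_eq z hk.le (fun _ hj => S.xSeq_le hj.le hk) fun _ hj hj' => S.xSeq_le hj hj'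

theorem continuous_solution (z : ℂ) : Continuous (S.solution z) := by
  refine Continuous.sub ?_ (continuous_const.mul (S.continuous_sum_truncSq _))
  simp only [halfSq_zero]
  fun_prop

theorem solvesEquation_solution (z : ℂ) : S.SolvesEquation z (S.solution z) := by
  refine ⟨(S.continuous_solution z).continuousOn, fun ψ hsmooth hcompact hsupport => ?_⟩
  have h : IsTestFunction 0 1 ψ := ⟨hsmooth, hcompact, hsupport⟩
  have hcont : Continuous fun ξ => ((iteratedDeriv 3 ψ ξ : ℝ) : ℂ) :=
    Complex.continuous_ofReal.comp (h.iteratedDeriv 3).continuous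
  have hquad : ∫ ξ in (0 : ℝ)..1, (halfSq 0 ξ : ℂ) * ((iteratedDeriv 3 ψ ξ : ℝ) : ℂ) = 0 := by
    simp_rw [← Complex.ofReal_mul]
    rw [intervalIntegral.integral_ofReal, Complex.ofReal_eq_zero]
    simpa only [sub_zero, h.left_eq_zero, neg_zero] using h.integral_halfSq_mul 0
  simp_rw [solution, sub_mul, mul_assoc z]
  rw [intervalIntegral.integral_sub, hquad, intervalIntegral.integral_const_mul,
    S.integral_sum_truncSq_mul _ h, S.integral_mass, zero_sub, mul_neg, neg_neg]
  · congr 1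
    refine Finset.sum_congr rfl fun j hj => ?_
    rw [← S.solution_xSeq z (Finset.mem_range.1 hj), solution]
    ring
  · refine Continuous.intervalIntegrable (Continuous.mul ?_ hcont) _ _
    simp only [halfSq_zero]
    fun_prop
  · exact (continuous_const.mul ((S.continuous_sum_truncSq _).mul hcont)).intervalIntegrable _ _

theorem eventually_le_xSeq : ∀ᶠ ξ in nhdsWithin (0 : ℝ) (Icc 0 1), ∀ j < n, ξ ≤ S.xSeq j :=
  (Filter.eventually_all_finite (finite_lt_nat n)).2 fun _ hj =>
    nhdsWithin_le_nhds (Iic_mem_nhds (S.xSeq_mem hj).1)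

theorem eventually_xSeq_le : ∀ᶠ ξ in nhdsWithin (1 : ℝ) (Icc 0 1), ∀ j < n, S.xSeq j ≤ ξ :=
  (Filter.eventually_all_finite (finite_lt_nat n)).2 fun _ hj =>
    nhdsWithin_le_nhds (Ici_mem_nhds (S.xSeq_mem hj).2)

section Uniqueness

variable {S} {z : ℂ} {f : ℝ → ℂ}

theorem SolvesEquation.exists_quadratic_sub_eq (h : S.SolvesEquation z f) :
    ∃ A : Fin 3 → ℂ, ∀ ξ ∈ Icc (0 : ℝ) 1, f ξ = A 0 + A 1 * ξ + A 2 * (ξ : ℂ) ^ 2 / 2 -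
      z * ∑ j ∈ Finset.range n,
        (S.gSeq j : ℂ) * f (S.xSeq j) * (truncSq (ξ - S.xSeq j) : ℂ) := by
  have hcont := S.continuous_sum_truncSq fun j => (S.gSeq j : ℂ) * f (S.xSeq j)
  obtain ⟨P, hP, hf⟩ := exists_eqOn_eval_of_integral_mul_iteratedDeriv_eq_zero zero_lt_one 3
    (f := fun ξ => f ξ + z * ∑ j ∈ Finset.range n,
      (S.gSeq j : ℂ) * f (S.xSeq j) * (truncSq (ξ - S.xSeq j) : ℂ))
    (h.1.add (continuous_const.mul hcont).continuousOn) (by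
      intro ψ hψ
      have hψ₃ := (hψ.iteratedDeriv 3).continuous
      simp_rw [add_mul, mul_assoc z]
      rw [intervalIntegral.integral_add, h.2 ψ hψ.1 hψ.2 hψ.3, intervalIntegral.integral_const_mul,
        S.integral_sum_truncSq_mul _ hψ, S.integral_mass, mul_neg, add_neg_eq_zero]
      · simp_rw [mul_assoc]
      · exact intervalIntegrable_mul_ofReal zero_lt_one h.1 hψ₃
      · exact (continuous_const.mul
          (hcont.mul (Complex.continuous_ofReal.comp hψ₃))).intervalIntegrable _ _)
  refine ⟨![P.coeff 0, P.coeff 1, 2 * P.coeff 2], fun ξ hξ => ?_⟩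
  have hfξ := hf hξ
  rw [eq_quadratic_of_degree_le_two (Order.le_of_lt_succ hP)] at hfξ
  simp only [eval_add, eval_mul, eval_C, eval_pow, eval_X] at hfξ
  simp only [Matrix.cons_val]
  linear_combination hfξ

theorem SolvesEquation.eq_halfSq_sub (h : S.SolvesEquation z f) (h₀ : stringDeriv 0 f 0 = 0)
    (h₁ : stringDeriv 1 f 0 = 0) {ξ : ℝ} (hξ : ξ ∈ Icc (0 : ℝ) 1) :
    f ξ = stringDeriv 2 f 0 * (halfSq 0 ξ : ℂ) - z * ∑ j ∈ Finset.range n,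
      (S.gSeq j : ℂ) * f (S.xSeq j) * (truncSq (ξ - S.xSeq j) : ℂ) := by
  obtain ⟨A, hf⟩ := h.exists_quadratic_sub_eq
  have hA (a : Fin 3) : stringDeriv a f 0 = A a := by
    refine stringDeriv_of_eventuallyEq (by simp) ?_ a
    filter_upwards [S.eventually_le_xSeq, self_mem_nhdsWithin] with ξ hξ hξ'
    rw [hf ξ hξ', S.sum_truncSq_eq n.zero_le (by simp) fun j _ hj => hξ j hj]
    simp
  have hA₀ : A 0 = 0 := (hA 0).symm.trans h₀
  have hA₁ : A 1 = 0 := (hA 1).symm.trans h₁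
  have hA₂ : stringDeriv 2 f 0 = A 2 := hA 2
  rw [hf ξ hξ, hA₀, hA₁, hA₂, halfSq_zero]
  push_cast
  ring

/-- The equation of `SolvesEquation.eq_halfSq_sub` is causal: it determines the value at each
mass from those at the preceding ones. -/
theorem SolvesEquation.apply_xSeq (h : S.SolvesEquation z f) (h₀ : stringDeriv 0 f 0 = 0)
    (h₁ : stringDeriv 1 f 0 = 0) {k : ℕ} (hk : k < n) :
    f (S.xSeq k) = stringDeriv 2 f 0 * S.solution z (S.xSeq k) := by
  induction k using Nat.strong_induction_on with
  | _ k ih =>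
    rw [h.eq_halfSq_sub h₀ h₁ (S.xSeq_mem_Icc hk), S.solution_xSeq z hk, nodalPoly,
      aeval_stringPoly, S.sum_truncSq_eq hk.le (fun j hj => S.xSeq_le hj.le hk)
        fun j hj hj' => S.xSeq_le hj hj', mul_sub, mul_left_comm _ z,
      Finset.mul_sum _ _ (stringDeriv 2 f 0)]
    congr 2
    refine Finset.sum_congr rfl fun j hj => ?_
    have hj := Finset.mem_range.1 hj
    rw [ih j hj (hj.trans hk), S.solution_xSeq z (hj.trans hk)]
    ring

theorem SolvesEquation.eqOn (h : S.SolvesEquation z f) (h₀ : stringDeriv 0 f 0 = 0)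
    (h₁ : stringDeriv 1 f 0 = 0) :
    EqOn f (fun ξ => stringDeriv 2 f 0 * S.solution z ξ) (Icc 0 1) := by
  intro ξ hξ
  rw [h.eq_halfSq_sub h₀ h₁ hξ]
  simp only [solution, mul_sub, mul_left_comm _ z, Finset.mul_sum]
  congr 1
  refine Finset.sum_congr rfl fun j hj => ?_
  have hj := Finset.mem_range.1 hj
  rw [h.apply_xSeq h₀ h₁ hj, S.solution_xSeq z hj]
  ring

theorem SolvesIVP.eqOn (h : S.SolvesIVP z f) : EqOn f (S.solution z) (Icc 0 1) := by
  obtain ⟨heq, h₀, h₁, h₂⟩ := h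
  simpa only [h₂, one_mul] using heq.eqOn h₀ h₁

theorem IsEigenfunction.exists_eqOn {a : Fin 3} (h : S.IsEigenfunction a z f) :
    ∃ c : ℂ, EqOn f (fun ξ => c * S.solution z ξ) (Icc 0 1) :=
  ⟨_, h.1.eqOn h.2.1 h.2.2.1⟩

end Uniqueness

theorem solvesIVP_solution (z : ℂ) : S.SolvesIVP z (S.solution z) := by
  have hjet : ∀ a : Fin 3, stringDeriv a (S.solution z) 0 = ![0, 0, 1] a := by
    refine stringDeriv_of_eventuallyEq (by simp) ?_
    filter_upwards [S.eventually_le_xSeq] with ξ hξ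
    rw [solution, S.sum_truncSq_eq n.zero_le (by simp) fun j _ hj => hξ j hj]
    simp [halfSq_zero]
  exact ⟨S.solvesEquation_solution z, hjet 0, hjet 1, hjet 2⟩

theorem exists_solution_ne_zero (z : ℂ) : ∃ ξ ∈ Icc (0 : ℝ) 1, S.solution z ξ ≠ 0 := by
  by_contra! h
  have hzero : stringDeriv 2 (S.solution z) 0 = 0 := by
    refine stringDeriv_of_eventuallyEq (A := 0) (by simp) ?_ 2
    filter_upwards [self_mem_nhdsWithin] with ξ hξ
    simpa using h ξ hξ
  exact zero_ne_one (hzero.symm.trans (S.solvesIVP_solution z).2.2.2)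

/-- The characteristic function of the boundary value problem of type `a`. -/
noncomputable def charPoly (a : Fin 3) : ℝ[X] := stringPoly S.gSeq S.xSeq n a 1

theorem stringDeriv_one_of_eqOn {z c : ℂ} {f : ℝ → ℂ}
    (h : EqOn f (fun ξ => c * S.solution z ξ) (Icc 0 1)) (a : Fin 3) :
    stringDeriv a f 1 = c * aeval z (S.charPoly a) := by
  refine stringDeriv_of_eventuallyEq (A := fun a => c * aeval z (S.charPoly a)) (by simp) ?_ a
  filter_upwards [S.eventually_xSeq_le, self_mem_nhdsWithin] with ξ hξ hξ'
  rw [h hξ']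
  dsimp only
  rw [S.solution_eq z le_rfl hξ fun j hj hj' => absurd hj' hj.not_gt, stringPoly_zero_eq n 1 ξ]
  simp only [charPoly, map_add, map_mul, aeval_C, Complex.coe_algebraMap, Complex.ofReal_div,
    Complex.ofReal_pow, Complex.ofReal_ofNat]
  ring

theorem stringDeriv_solution_one (z : ℂ) (a : Fin 3) :
    stringDeriv a (S.solution z) 1 = aeval z (S.charPoly a) := by
  rw [S.stringDeriv_one_of_eqOn (c := 1) (fun ξ _ => (one_mul _).symm), one_mul]

theorem isEigenfunction_solution {a : Fin 3} {z : ℂ} (h : aeval z (S.charPoly a) = 0) :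
    S.IsEigenfunction a z (S.solution z) :=
  ⟨S.solvesEquation_solution z, (S.solvesIVP_solution z).2.1, (S.solvesIVP_solution z).2.2.1,
    (S.stringDeriv_solution_one z a).trans h, S.exists_solution_ne_zero z⟩

theorem mem_spectrum_iff (a : Fin 3) (z : ℂ) : z ∈ S.spectrum a ↔ aeval z (S.charPoly a) = 0 := by
  refine ⟨?_, fun h => ⟨_, S.isEigenfunction_solution h⟩⟩
  rintro ⟨f, hf, h₀, h₁, ha, ξ, hξ, hne⟩
  have hfc := hf.eqOn h₀ h₁
  rw [S.stringDeriv_one_of_eqOn hfc, mul_eq_zero] at ha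
  refine ha.resolve_left fun hc => hne ?_
  rw [hfc hξ, hc]
  exact zero_mul _

theorem exists_interlacedTriple_charPoly : ∃ ζ, InterlacedTriple n S.charPoly ζ :=
  exists_interlacedTriple_stringPoly n (fun _ hj => S.gSeq_pos hj) (fun _ hj => (S.xSeq_mem hj).1)
    (fun _ _ hij hj => S.xSeq_lt hij hj) one_pos fun _ hj => (S.xSeq_mem hj).2

section Eigenvalues

variable {S} {a : Fin 3} {ζ : ℕ → ℝ} (hζ : HasRootSeq (S.charPoly a) n ζ)
include hζ

theorem spectrum_eq_range : S.spectrum a = range fun j : Fin n => (ζ j : ℂ) := by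
  ext z
  rw [S.mem_spectrum_iff, hζ.aeval_eq_zero_iff]
  exact ⟨fun ⟨j, hj, hz⟩ => ⟨⟨j, hj⟩, hz.symm⟩, fun ⟨j, hz⟩ => ⟨j, j.2, hz.symm⟩⟩

theorem isEigenfunction_solution_of_hasRootSeq (j : Fin n) :
    S.IsEigenfunction a (ζ j) (S.solution (ζ j)) :=
  S.isEigenfunction_solution (hζ.aeval_eq_zero_iff.2 ⟨j, j.2, rfl⟩)

theorem deriv_stringDeriv_solution_ne_zero (hinj : InjOn ζ (Finset.range n)) (j : Fin n) :
    deriv (fun z => stringDeriv a (S.solution z) 1) (ζ j) ≠ 0 := by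
  simp_rw [stringDeriv_solution_one]
  rw [Polynomial.deriv_aeval, ← Complex.coe_algebraMap,
    aeval_algebraMap_apply_eq_algebraMap_eval, Complex.coe_algebraMap, Complex.ofReal_ne_zero]
  exact hζ.eval_derivative_ne_zero hinj j.2

end Eigenvalues

theorem degree_nodalPoly {k : ℕ} (hk : k < n) : (nodalPoly S.gSeq S.xSeq k).degree = k := by
  obtain ⟨ζ, hζ⟩ := exists_interlacedTriple_stringPoly (g := S.gSeq) (x := S.xSeq) k
    (fun j hj => S.gSeq_pos (hj.trans hk)) (fun j hj => (S.xSeq_mem (hj.trans hk)).1)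
    (fun i j hij hj => S.xSeq_lt hij (hj.trans hk)) (S.xSeq_mem hk).1
    fun j hj => S.xSeq_lt hj hk
  have hroot : HasRootSeq (nodalPoly S.gSeq S.xSeq k) k (ζ 0) := hζ.hasRootSeq 0
  rw [degree_eq_natDegree hroot.ne_zero, hroot.natDegree_eq]

section LinearIndependence

variable {ζ : Fin n → ℂ} (hζ : Function.Injective ζ)
include hζ

theorem linearIndependent_solution_xSeq :
    LinearIndependent ℂ fun j (i : Fin n) => S.solution (ζ j) (S.xSeq i) := by
  have h := linearIndependent_eval_of_degree_eq
    (P := fun i : Fin n => (nodalPoly S.gSeq S.xSeq i).map (algebraMap ℝ ℂ))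
    (fun i => by rw [degree_map, S.degree_nodalPoly i.2]) hζ
  simpa only [eval_map_algebraMap, ← S.solution_xSeq _ (Fin.is_lt _)] using h

theorem linearIndependent_domRestrict_solution :
    LinearIndependent ℂ fun j => (Icc (0 : ℝ) 1).domRestrict (S.solution (ζ j)) :=
  .of_comp (LinearMap.funLeft ℂ ℂ fun i : Fin n => (⟨S.xSeq i, S.xSeq_mem_Icc i.2⟩ : Icc (0 : ℝ) 1))
    (S.linearIndependent_solution_xSeq hζ)

theorem linearIndependent_germ_solution :
    LinearIndependent ℂ
      fun j => (Filter.Germ.ofFun (S.solution (ζ j)) : Filter.Germ (ae S.mass) ℂ) := by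
  let nodalValues : Filter.Germ (ae S.mass) ℂ →ₗ[ℂ] Fin n → ℂ :=
    { toFun := fun G => G.liftOn (fun f i => f (S.xSeq i)) fun _ _ h =>
        funext fun i => S.of_ae_mass h i.2
      map_add' := by rintro ⟨f⟩ ⟨h⟩; rfl
      map_smul' := by rintro c ⟨f⟩; rfl }
  exact .of_comp nodalValues (S.linearIndependent_solution_xSeq hζ)

end LinearIndependence

theorem form_solution {z w : ℂ} (h : z + w ≠ 0) : S.form (S.solution z) (S.solution w) =
    (stringDeriv 1 (S.solution z) 1 * stringDeriv 1 (S.solution w) 1 -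
      stringDeriv 2 (S.solution z) 1 * stringDeriv 0 (S.solution w) 1 -
      stringDeriv 0 (S.solution z) 1 * stringDeriv 2 (S.solution w) 1) / (z + w) := by
  have hjet (z : ℂ) (a : Fin 3) :
      stringDeriv a (S.solution z) 1 = aeval z (stringPoly S.gSeq S.xSeq n a 1) :=
    S.stringDeriv_solution_one z a
  have hlagrange := lagrange_identity (g := S.gSeq) (x := S.xSeq) z w n 1
  simp only [← hjet] at hlagrange
  rw [eq_div_iff h, mul_comm, form, S.integral_mass]
  refine Eq.trans ?_ hlagrange
  congr 1
  refine Finset.sum_congr rfl fun j hj => ?_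
  rw [S.solution_xSeq _ (Finset.mem_range.1 hj), S.solution_xSeq _ (Finset.mem_range.1 hj)]

end DiscreteCubicString

theorem mainTheorem2 (n : ℕ) (S : DiscreteCubicString n) :
    -- the solution `φ z` of the initial value problem, unique on `[0,1]`
    ∃ φ : ℂ → ℝ → ℂ,
      (∀ z, S.SolvesIVP z (φ z)) ∧
      (∀ z f, S.SolvesIVP z f → EqOn f (φ z) (Icc 0 1)) ∧
      -- the eigenvalues `ζ a j` of type `a`, in increasing order
      ∃ ζ : Fin 3 → Fin n → ℝ,
        (∀ a, StrictMono (ζ a)) ∧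
        (∀ a, S.spectrum a = range (fun j => (ζ a j : ℂ))) ∧
        (∀ a j, 0 < ζ a j) ∧
        -- simplicity: `φ (ζ a j)` spans the eigenspace, and `ζ a j` is a simple zero of the
        -- characteristic function `z ↦ (d/dξ)ᵃ φ z (1)`
        (∀ a j, S.IsEigenfunction a (ζ a j) (φ (ζ a j))) ∧
        (∀ a j f, S.IsEigenfunction a (ζ a j) f →
          ∃ c : ℂ, EqOn f (fun ξ => c * φ (ζ a j) ξ) (Icc 0 1)) ∧
        (∀ (a : Fin 3) j, deriv (fun z => stringDeriv (a : ℕ) (φ z) 1) (ζ a j) ≠ 0) ∧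
        -- interlacing
        (∀ j, ζ 2 j < ζ 1 j ∧ ζ 1 j < ζ 0 j) ∧
        (∀ j k, j < k → ζ 0 j < ζ 2 k) ∧
        -- linear independence, as functions on `[0,1]` and modulo `g`-null sets
        (∀ a, LinearIndependent ℂ (fun j => (Icc (0 : ℝ) 1).domRestrict (φ (ζ a j)))) ∧
        (∀ a, LinearIndependent ℂ
          (fun j => (Filter.Germ.ofFun (φ (ζ a j)) : Filter.Germ (ae S.mass) ℂ))) ∧
        -- factorization for the types 00, 01, 12 and 22
        (∀ i j, S.form (φ (ζ 0 i)) (φ (ζ 0 j)) =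
          stringDeriv 1 (φ (ζ 0 i)) 1 * stringDeriv 1 (φ (ζ 0 j)) 1 / (ζ 0 i + ζ 0 j)) ∧
        (∀ i j, S.form (φ (ζ 0 i)) (φ (ζ 1 j)) =
          -(stringDeriv 2 (φ (ζ 0 i)) 1 * stringDeriv 0 (φ (ζ 1 j)) 1) / (ζ 0 i + ζ 1 j)) ∧
        (∀ i j, S.form (φ (ζ 1 i)) (φ (ζ 2 j)) =
          -(stringDeriv 2 (φ (ζ 1 i)) 1 * stringDeriv 0 (φ (ζ 2 j)) 1) / (ζ 1 i + ζ 2 j)) ∧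
        (∀ i j, S.form (φ (ζ 2 i)) (φ (ζ 2 j)) =
          stringDeriv 1 (φ (ζ 2 i)) 1 * stringDeriv 1 (φ (ζ 2 j)) 1 / (ζ 2 i + ζ 2 j)) := by
  obtain ⟨ζ, hζ⟩ := S.exists_interlacedTriple_charPoly
  have hmono (a) : StrictMono fun j : Fin n => ζ a j := fun _ k hjk => hζ.lt a hjk k.2
  have hinj (a) : Function.Injective fun j : Fin n => (ζ a j : ℂ) :=
    Complex.ofReal_injective.comp (hmono a).injective
  have hsum (a b) (i j : Fin n) : (ζ a i : ℂ) + ζ b j ≠ 0 := by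
    exact_mod_cast (add_pos (hζ.pos a i.2) (hζ.pos b j.2)).ne'
  have heigen (a) := DiscreteCubicString.isEigenfunction_solution_of_hasRootSeq (hζ.hasRootSeq a)
  have h₀ (j) : stringDeriv 0 (S.solution (ζ 0 (j : Fin n))) 1 = 0 := (heigen 0 j).2.2.2.1
  have h₁ (j) : stringDeriv 1 (S.solution (ζ 1 (j : Fin n))) 1 = 0 := (heigen 1 j).2.2.2.1
  have h₂ (j) : stringDeriv 2 (S.solution (ζ 2 (j : Fin n))) 1 = 0 := (heigen 2 j).2.2.2.1
  exact ⟨S.solution, S.solvesIVP_solution, fun z f hf => hf.eqOn, fun a j => ζ a j, hmono,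
    fun a => DiscreteCubicString.spectrum_eq_range (hζ.hasRootSeq a), fun a j => hζ.pos a j.2,
    heigen, fun a j f hf => hf.exists_eqOn,
    fun a => DiscreteCubicString.deriv_stringDeriv_solution_ne_zero (hζ.hasRootSeq a) (hζ.injOn a),
    fun j => ⟨hζ.two_lt_one j j.2, hζ.one_lt_zero j j.2⟩, fun j k hjk => hζ.zero_lt_two j k hjk k.2,
    fun a => S.linearIndependent_domRestrict_solution (hinj a),
    fun a => S.linearIndependent_germ_solution (hinj a),
    fun i j => by simp [S.form_solution (hsum 0 0 i j), h₀],
    fun i j => by simp [S.form_solution (hsum 0 1 i j), h₀, h₁],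
    fun i j => by simp [S.form_solution (hsum 1 2 i j), h₁, h₂],
    fun i j => by simp [S.form_solution (hsum 2 2 i j), h₂]⟩
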